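/- Let $c>0$, $\mu>0$, $\sigma\ge 0$ and $\alpha\ge 0$. Let $\mathcal P$ be the set of probability measures on $\mathbb R_+=[0,\infty)$ and let $\mathcal A=\{G\in\mathcal P:\ \mathbb E_G[\tilde v]=\mu,\ \mathbb E_G[\tilde v^2]=\mu^2+\sigma^2\}$. For a unit price $p>c$, a unit cost $c$, an order quantity $q\ge 0$ and a demand $v\ge 0$, let the profit be $\pi(q,v)=p\min\{q,v\}-cq$. For $F,G\in\mathcal P$ let $d_{\rm OT}(F,G)=\inf_{\Gamma}\int_{\mathbb R_+\times\mathbb R_+}|u-v|^2\,{\rm d}\Gamma(u,v)\in[0,\infty]$, where $\Gamma$ ranges over the joint distributions on $\mathbb R_+\times\mathbb R_+$ with marginals $F$ and $G$, and let $d(F,\mathcal A)=\inf_{G\in\mathcal A}d_{\rm OT}(F,G)$. Consider the misspecification-averse newsvendor problem $$\max_{q\ge 0}\ \inf_{F\in\mathcal P}\big\{\mathbb E_F[\pi(q,\tilde u)]+\alpha\, d(F,\mathcal A)\big\}.$$ Then there is a threshold $p_\alpha\ge\max\big\{\tfrac{\mu^2+\sigma^2}{\mu^2}\,c,\ 2\alpha\mu\big\}$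 such that, for every $p>p_\alpha$, this problem has a unique optimal order quantity $q_\alpha^\star=q_\alpha^\star(p)$, and $q^\star_\alpha$ is decreasing (in the weak sense) in $p\in(p_\alpha,\infty)$, with $c,\mu,\sigma,\alpha$ held fixed. This reverses the monotonicity of the Scarf (ambiguity-averse) model $\max_{q\ge 0}\inf_{G\in\mathcal A}\mathbb E_G[\pi(q,\tilde v)]$: that model has an optimal order quantity for every $p>c$, and its optimal order quantities are increasing (in the weak sense) in $p$, that is, if $c<p_1<p_2$ and $q_1$, $q_2$ are optimal for the prices $p_1$, $p_2$, then $q_1\le q_2$. -/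

import Mathlib

open MeasureTheory Set
open scoped NNReal ENNReal

noncomputable section

namespace Newsvendor

/-- The profit `π(q, v) = p · min {q, v} - c q` of ordering `q` units at unit cost `c`
and selling at unit price `p` under the realized demand `v`. -/
def profit (p c q v : ℝ) : ℝ := p * min q v - c * q

/-- The expected profit of the order quantity `q` under the demand distribution `F` on `[0, ∞)`.
For `0 ≤ q` the integrand is bounded, so the integral is a genuine expectation. -/
def expectedProfit (p c q : ℝ) (F : ProbabilityMeasure ℝ≥0) : ℝ :=
  ∫ v : ℝ≥0, profit p c q (v : ℝ) ∂(F : Measure ℝ≥0)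

/-- The mean-variance ambiguity set: the distributions on `[0, ∞)` with mean `μ` and
second moment `μ² + σ²`. -/
def ambiguitySet (μ σ : ℝ) : Set (ProbabilityMeasure ℝ≥0) :=
  {G | Integrable (fun v : ℝ≥0 => (v : ℝ) ^ 2) (G : Measure ℝ≥0) ∧
    ∫ v : ℝ≥0, (v : ℝ) ∂(G : Measure ℝ≥0) = μ ∧
    ∫ v : ℝ≥0, (v : ℝ) ^ 2 ∂(G : Measure ℝ≥0) = μ ^ 2 + σ ^ 2}

/-- The joint distributions on `[0, ∞) × [0, ∞)` with marginals `F` and `G`. -/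
def couplings (F G : ProbabilityMeasure ℝ≥0) : Set (ProbabilityMeasure (ℝ≥0 × ℝ≥0)) :=
  {Γ | (Γ : Measure (ℝ≥0 × ℝ≥0)).fst = (F : Measure ℝ≥0) ∧
    (Γ : Measure (ℝ≥0 × ℝ≥0)).snd = (G : Measure ℝ≥0)}

/-- The optimal-transport cost between `F` and `G` for the quadratic cost `|u - v|²`
(the square of the type-2 Wasserstein distance), possibly infinite. -/
def transportCost (F G : ProbabilityMeasure ℝ≥0) : ℝ≥0∞ :=
  ⨅ Γ ∈ couplings F G,
    ∫⁻ z : ℝ≥0 × ℝ≥0, ENNReal.ofReal (|(z.1 : ℝ) - (z.2 : ℝ)| ^ 2) ∂(Γ : Measure (ℝ≥0 × ℝ≥0))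

/-- The optimal-transport cost `d(F, A)` from `F` to a set `A` of distributions. -/
def transportCostToSet (F : ProbabilityMeasure ℝ≥0) (A : Set (ProbabilityMeasure ℝ≥0)) : ℝ≥0∞ :=
  ⨅ G ∈ A, transportCost F G

/-- The objective of the misspecification-averse newsvendor:
`q ↦ inf_F { E_F[π(q, ũ)] + α · d(F, A) }`, with `F` ranging over all distributions on `[0, ∞)`. -/
def misspecificationObjective (p c α μ σ q : ℝ) : EReal :=
  ⨅ F : ProbabilityMeasure ℝ≥0,
    ((expectedProfit p c q F : ℝ) : EReal) +
      ((ENNReal.ofReal α * transportCostToSet F (ambiguitySet μ σ) : ℝ≥0∞) : EReal)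

/-- The objective of the (Scarf) ambiguity-averse newsvendor: `q ↦ inf_{G ∈ A} E_G[π(q, ṽ)]`. -/
def ambiguityObjective (p c μ σ q : ℝ) : EReal :=
  ⨅ G ∈ ambiguitySet μ σ, ((expectedProfit p c q G : ℝ) : EReal)

/-- `q` is an optimal order quantity for the objective `L`: a maximizer of `L` over `[0, ∞)`. -/
def IsOptimalOrder (L : ℝ → EReal) (q : ℝ) : Prop :=
  0 ≤ q ∧ ∀ q' : ℝ, 0 ≤ q' → L q' ≤ L q

end Newsvendor

end

namespace Newsvendor

/-! Eliminating `F` turns the problem into a moment problem. If `4 * α * q ≤ p`, moving demand `v`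
to `u` leaves at least `min (p * q) (α * v ^ 2)`: the adversary either wipes demand out at cost `α *
v ^ 2` or concedes full sales (`min_le_revenue_add_cost`).

Let `σ > 0` and `p = c * (1 + r ^ 2)`. The extremal law has atoms `x = μ - σ / r` and `y = μ + σ *
r`, and the adversary sends `x` to `0`. The atom `y` has mass `c / p`, so the resulting upper bound
on the objective does not depend on `q`; it is the value `V`. At `q = α * x * y / p` a quadratic
touching `min (x * y) (v ^ 2)` at `x` and `y` gives the matching lower bound (`quadratic_le_min`).
Any other optimal `q` must satisfy the same first-order condition in the position of the lower atom,
which determines it (`first_order_condition`).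

Since `x * y = μ ^ 2 - σ ^ 2 + μ * σ * (r - 1 / r)` grows only like the square root of `p`, the
quotient `α * x * y / p` eventually decreases. In the Scarf model the worst-case sales do not depend
on `p`, and an exchange argument gives the opposite monotonicity. -/

/-- The law giving mass `w` to `a` and mass `1 - w` to `b`. -/
noncomputable def twoPoint {β : Type*} [MeasurableSpace β] (w : ℝ) (hw : 0 ≤ w) (hw' : w ≤ 1) (a b : β) :
    ProbabilityMeasure β :=
  ⟨ENNReal.ofReal w • Measure.dirac a + ENNReal.ofReal (1 - w) • Measure.dirac b, ⟨by
    simp only [Measure.coe_add, Measure.coe_smul, Pi.add_apply, Pi.smul_apply, measure_univ,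
      smul_eq_mul, mul_one]
    rw [← ENNReal.ofReal_add hw (sub_nonneg.2 hw')]
    simp⟩⟩

/-! ### Integration against two-point laws. -/

section TwoPoint

variable {β γ : Type*} [MeasurableSpace β] [MeasurableSpace γ] {w : ℝ} (hw : 0 ≤ w) (hw' : w ≤ 1)

theorem coe_twoPoint (a b : β) : (twoPoint w hw hw' a b : Measure β) =
    ENNReal.ofReal w • Measure.dirac a + ENNReal.ofReal (1 - w) • Measure.dirac b := rfl

theorem map_twoPoint {f : β → γ} (hf : Measurable f) (a b : β) :
    (twoPoint w hw hw' a b : Measure β).map f = twoPoint w hw hw' (f a) (f b) := by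
  simp [coe_twoPoint, Measure.map_add _ _ hf, Measure.map_smul, Measure.map_dirac' hf]

theorem integrable_twoPoint [MeasurableSingletonClass β] (f : β → ℝ) (a b : β) :
    Integrable f (twoPoint w hw hw' a b : Measure β) := by
  rw [coe_twoPoint, integrable_add_measure]
  exact ⟨(integrable_dirac (by simp)).smul_measure (by simp),
    (integrable_dirac (by simp)).smul_measure (by simp)⟩

theorem integral_twoPoint [MeasurableSingletonClass β] (f : β → ℝ) (a b : β) :
    ∫ v, f v ∂(twoPoint w hw hw' a b : Measure β) = w * f a + (1 - w) * f b := by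
  rw [coe_twoPoint, integral_add_measure]
  · simp [integral_smul_measure, hw, hw']
  · exact (integrable_dirac (by simp)).smul_measure (by simp)
  · exact (integrable_dirac (by simp)).smul_measure (by simp)

theorem lintegral_twoPoint [MeasurableSingletonClass β] (f : β → ℝ) (hf : ∀ v, 0 ≤ f v)
    (a b : β) : ∫⁻ v, ENNReal.ofReal (f v) ∂(twoPoint w hw hw' a b : Measure β) =
      ENNReal.ofReal (w * f a + (1 - w) * f b) := by
  rw [← integral_twoPoint hw hw', ofReal_integral_eq_lintegral_ofReal
    (integrable_twoPoint hw hw' f a b) (Filter.Eventually.of_forall hf)]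

end TwoPoint

/-! ### Upper bounds on the objective from two-point laws. -/

/-- A pair of two-point laws, coupled atom by atom, bounds the worst-case objective. -/
theorem misspecificationObjective_le_twoPoint {p c α μ σ q w : ℝ} (hα : 0 ≤ α) (hw : 0 ≤ w)
    (hw' : w ≤ 1) {a b x y : ℝ} (ha : 0 ≤ a) (hb : 0 ≤ b) (hx : 0 ≤ x) (hy : 0 ≤ y)
    (h₁ : w * x + (1 - w) * y = μ)
    (h₂ : w * x ^ 2 + (1 - w) * y ^ 2 = μ ^ 2 + σ ^ 2) :
    misspecificationObjective p c α μ σ q ≤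
      ((w * (profit p c q a + α * (a - x) ^ 2) +
        (1 - w) * (profit p c q b + α * (b - y) ^ 2) : ℝ) : EReal) := by
  lift a to ℝ≥0 using ha
  lift b to ℝ≥0 using hb
  lift x to ℝ≥0 using hx
  lift y to ℝ≥0 using hy
  have hG : twoPoint w hw hw' x y ∈ ambiguitySet μ σ :=
    ⟨integrable_twoPoint hw hw' _ x y, by rw [integral_twoPoint, h₁], by
      rw [integral_twoPoint, h₂]⟩
  have hΓ : twoPoint w hw hw' (a, x) (b, y) ∈
      couplings (twoPoint w hw hw' a b) (twoPoint w hw hw' x y) :=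
    ⟨map_twoPoint hw hw' measurable_fst _ _, map_twoPoint hw hw' measurable_snd _ _⟩
  have hd : transportCostToSet (twoPoint w hw hw' a b) (ambiguitySet μ σ) ≤
      ENNReal.ofReal (w * |(a : ℝ) - x| ^ 2 + (1 - w) * |(b : ℝ) - y| ^ 2) := by
    refine (iInf₂_le _ hG).trans ((iInf₂_le _ hΓ).trans_eq ?_)
    exact lintegral_twoPoint hw hw' (fun z : ℝ≥0 × ℝ≥0 => |(z.1 : ℝ) - (z.2 : ℝ)| ^ 2)
      (fun _ => by positivity) _ _
  have hs : (0 : ℝ) ≤ w * |(a : ℝ) - x| ^ 2 + (1 - w) * |(b : ℝ) - y| ^ 2 := by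
    have := sub_nonneg.2 hw'
    positivity
  have hm : ENNReal.ofReal α * transportCostToSet (twoPoint w hw hw' a b) (ambiguitySet μ σ) ≤
      ENNReal.ofReal (α * (w * |(a : ℝ) - x| ^ 2 + (1 - w) * |(b : ℝ) - y| ^ 2)) := by
    rw [ENNReal.ofReal_mul hα]
    gcongr
  refine (iInf_le _ (twoPoint w hw hw' a b)).trans ?_
  refine (add_le_add_right (EReal.coe_ennreal_le_coe_ennreal_iff.2 hm) _).trans_eq ?_
  rw [EReal.coe_ennreal_ofReal, max_eq_left (mul_nonneg hα hs), ← EReal.coe_add, expectedProfit,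
    integral_twoPoint]
  congr 1
  simp only [sq_abs]
  ring

/-- The two-point law at `μ - z` and `μ + σ² / z` has mean `μ` and variance `σ²`. -/
theorem twoPoint_moments (μ σ : ℝ) {z : ℝ} (hz : 0 < z) :
    σ ^ 2 / (z ^ 2 + σ ^ 2) * (μ - z) + (1 - σ ^ 2 / (z ^ 2 + σ ^ 2)) * (μ + σ ^ 2 / z) = μ ∧
    σ ^ 2 / (z ^ 2 + σ ^ 2) * (μ - z) ^ 2 + (1 - σ ^ 2 / (z ^ 2 + σ ^ 2)) * (μ + σ ^ 2 / z) ^ 2 =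
      μ ^ 2 + σ ^ 2 := by
  have : z ^ 2 + σ ^ 2 ≠ 0 := by positivity
  constructor <;> field_simp <;> ring

theorem variance_weight_le_one (σ : ℝ) {z : ℝ} (hz : 0 < z) : σ ^ 2 / (z ^ 2 + σ ^ 2) ≤ 1 := by
  rw [div_le_one (by positivity)]
  nlinarith

theorem ambiguitySet_nonempty {μ : ℝ} (σ : ℝ) (hμ : 0 < μ) : (ambiguitySet μ σ).Nonempty := by
  obtain ⟨h₁, h₂⟩ := twoPoint_moments μ σ hμ
  have hw : 0 ≤ σ ^ 2 / (μ ^ 2 + σ ^ 2) := by positivity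
  have hw' := variance_weight_le_one σ hμ
  have hy : 0 ≤ μ + σ ^ 2 / μ := by positivity
  generalize μ + σ ^ 2 / μ = y at h₁ h₂ hy
  lift y to ℝ≥0 using hy
  refine ⟨twoPoint _ hw hw' 0 y, integrable_twoPoint hw hw' _ _ _,
    ?_, ?_⟩
  · rw [integral_twoPoint]
    simpa using h₁
  · rw [integral_twoPoint]
    simpa using h₂

/-- The adversary moves the lower atom `μ - z` to `0`, where nothing is sold, and leaves the upper
atom in place. -/
theorem misspecificationObjective_le {p c α μ σ q z : ℝ} (hp : 0 ≤ p) (hq : 0 ≤ q) (hα : 0 ≤ α)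
    (hz : 0 < z) (hzμ : z ≤ μ) :
    misspecificationObjective p c α μ σ q ≤
      (((σ ^ 2 * α * (μ - z) ^ 2 + z ^ 2 * (p * q)) / (z ^ 2 + σ ^ 2) - c * q : ℝ) : EReal) := by
  obtain ⟨h₁, h₂⟩ := twoPoint_moments μ σ hz
  have hy : 0 ≤ μ + σ ^ 2 / z := by
    have := hz.le.trans hzμ
    positivity
  have hw' := variance_weight_le_one σ hz
  refine (misspecificationObjective_le_twoPoint hα (by positivity) hw' le_rfl hy
    (sub_nonneg.2 hzμ) hy h₁ h₂).trans ?_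
  rw [EReal.coe_le_coe_iff]
  simp only [profit, min_eq_right hq]
  have hmin : p * min q (μ + σ ^ 2 / z) ≤ p * q := by gcongr; exact min_le_left _ _
  have h := mul_le_mul_of_nonneg_left hmin (sub_nonneg.2 hw')
  have hne : z ^ 2 + σ ^ 2 ≠ 0 := by positivity
  have e : (σ ^ 2 * α * (μ - z) ^ 2 + z ^ 2 * (p * q)) / (z ^ 2 + σ ^ 2) - c * q =
      σ ^ 2 / (z ^ 2 + σ ^ 2) * (α * (μ - z) ^ 2 - c * q) +
        (1 - σ ^ 2 / (z ^ 2 + σ ^ 2)) * (p * q - c * q) := by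
    field_simp
    ring
  rw [e]
  linarith

/-! ### Lower bounds by eliminating the transported law. -/

/-- A lower bound for the infimal convolution of the revenue with the quadratic cost. -/
theorem min_le_revenue_add_cost {p α q u v : ℝ} (hα : 0 ≤ α) (hp : 0 ≤ p)
    (hqp : 4 * α * q ≤ p) (hu : 0 ≤ u) : min (p * q) (α * v ^ 2) ≤
      p * min q u + α * |u - v| ^ 2 := by
  rw [sq_abs]
  rcases le_total q u with h | h
  · rw [min_eq_left h]
    exact (min_le_left _ _).trans (le_add_of_nonneg_right (by positivity))
  rw [min_eq_right h]
  -- For `2 * α * v ≤ p` the expression `p * u + α * (u - v) ^ 2` is nondecreasing on `u ≥ 0`, so `u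
  -- = 0` is worst. Otherwise, if `α > 0`, completing the square gives at least `p * v - p ^ 2 / (4
  -- * α) ≥ p ^ 2 / (4 * α) ≥ p * q`.
  rcases le_total (2 * α * v) p with hv | hv
  · refine (min_le_right _ _).trans ?_
    nlinarith [mul_nonneg hu (sub_nonneg.2 hv), mul_nonneg hα (sq_nonneg u)]
  · refine (min_le_left _ _).trans ?_
    rcases hα.eq_or_lt with rfl | hα
    · have : p = 0 := by linarith
      simp [this]
    · have h1 : 4 * α * (p * q) ≤ 4 * α * (p * u + α * (u - v) ^ 2) := by
        nlinarith [mul_nonneg hp (sub_nonneg.2 hqp), mul_nonneg hp (sub_nonneg.2 hv),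
          sq_nonneg (2 * α * (u - v) + p)]
      exact le_of_mul_le_mul_left h1 (by positivity)

theorem integrable_min_left {β : Type*} [MeasurableSpace β] (P : ProbabilityMeasure β) {f : β → ℝ}
    (hf : Measurable f) (hf₀ : ∀ v, 0 ≤ f v) {q : ℝ} (hq : 0 ≤ q) :
    Integrable (fun v => min q (f v)) (P : Measure β) := by
  refine Integrable.of_bound (measurable_const.min hf).aestronglyMeasurable q
    (Filter.Eventually.of_forall fun v => ?_)
  rw [Real.norm_of_nonneg (le_min hq (hf₀ v))]
  exact min_le_left _ _

theorem integrable_min_coe (F : ProbabilityMeasure ℝ≥0) {q : ℝ} (hq : 0 ≤ q) :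
    Integrable (fun v : ℝ≥0 => min q (v : ℝ)) (F : Measure ℝ≥0) :=
  integrable_min_left F measurable_coe_nnreal_real (fun v => v.2) hq

theorem expectedProfit_eq {p c q : ℝ} (hq : 0 ≤ q) (F : ProbabilityMeasure ℝ≥0) :
    expectedProfit p c q F = p * ∫ v : ℝ≥0, min q (v : ℝ) ∂(F : Measure ℝ≥0) - c * q := by
  simp only [expectedProfit, profit]
  rw [integral_sub ((integrable_min_coe F hq).const_mul p) (integrable_const _),
    integral_const_mul]
  simp

theorem integral_min_le_of_coupling {p c α q : ℝ} (hα : 0 ≤ α) (hp : 0 ≤ p) (hq : 0 ≤ q)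
    (hqp : 4 * α * q ≤ p) {F G : ProbabilityMeasure ℝ≥0} {Γ : ProbabilityMeasure (ℝ≥0 × ℝ≥0)}
    (hΓ : Γ ∈ couplings F G)
    (hint : Integrable (fun z : ℝ≥0 × ℝ≥0 => |(z.1 : ℝ) - (z.2 : ℝ)| ^ 2)
      (Γ : Measure (ℝ≥0 × ℝ≥0))) :
    ∫ v : ℝ≥0, min (p * q) (α * (v : ℝ) ^ 2) ∂(G : Measure ℝ≥0) - c * q ≤
      expectedProfit p c q F +
        α * ∫ z : ℝ≥0 × ℝ≥0, |(z.1 : ℝ) - (z.2 : ℝ)| ^ 2 ∂(Γ : Measure (ℝ≥0 × ℝ≥0)) := by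
  have e₁ : ∫ z, min q (z.1 : ℝ) ∂(Γ : Measure (ℝ≥0 × ℝ≥0)) =
      ∫ u : ℝ≥0, min q (u : ℝ) ∂(F : Measure ℝ≥0) := by
    rw [← hΓ.1, Measure.fst, integral_map measurable_fst.aemeasurable]
    exact (measurable_const.min measurable_coe_nnreal_real).aestronglyMeasurable
  have e₂ : ∫ z, min (p * q) (α * (z.2 : ℝ) ^ 2) ∂(Γ : Measure (ℝ≥0 × ℝ≥0)) =
      ∫ v : ℝ≥0, min (p * q) (α * (v : ℝ) ^ 2) ∂(G : Measure ℝ≥0) := by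
    rw [← hΓ.2, Measure.snd, integral_map measurable_snd.aemeasurable]
    exact Measurable.aestronglyMeasurable (by fun_prop)
  have i₁ : Integrable (fun z : ℝ≥0 × ℝ≥0 => p * min q (z.1 : ℝ)) (Γ : Measure (ℝ≥0 × ℝ≥0)) :=
    (integrable_min_left Γ (by fun_prop) (fun z => z.1.2) hq).const_mul p
  have i₂ : Integrable (fun z : ℝ≥0 × ℝ≥0 => min (p * q) (α * (z.2 : ℝ) ^ 2))
      (Γ : Measure (ℝ≥0 × ℝ≥0)) :=
    integrable_min_left Γ (by fun_prop) (fun z => by positivity) (mul_nonneg hp hq)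
  have h := integral_mono i₂ (i₁.add (hint.const_mul α)) fun z =>
    min_le_revenue_add_cost hα hp hqp z.1.2
  simp only [Pi.add_apply] at h
  rw [integral_add i₁ (hint.const_mul α), integral_const_mul, integral_const_mul, e₁, e₂] at h
  rw [expectedProfit_eq hq]
  linarith

theorem le_misspecificationObjective {p c α μ σ q V : ℝ} (hα : 0 ≤ α) (hμ : 0 < μ) (hp : 0 ≤ p)
    (hq : 0 ≤ q) (hqp : 4 * α * q ≤ p)
    (hV : ∀ G ∈ ambiguitySet μ σ,
      V ≤ ∫ v : ℝ≥0, min (p * q) (α * (v : ℝ) ^ 2) ∂(G : Measure ℝ≥0) - c * q) :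
    (V : EReal) ≤ misspecificationObjective p c α μ σ q := by
  refine le_iInf fun F => ?_
  -- Moving the profit across puts the comparison in `ℝ≥0∞`; truncation at `0` is harmless because
  -- the transport term is nonnegative.
  suffices h : ENNReal.ofReal (V - expectedProfit p c q F) ≤
      ENNReal.ofReal α * transportCostToSet F (ambiguitySet μ σ) by
    refine le_trans ?_ (add_le_add_right (EReal.coe_ennreal_le_coe_ennreal_iff.2 h) _)
    rw [EReal.coe_ennreal_ofReal, ← EReal.coe_add, EReal.coe_le_coe_iff]
    linarith [le_max_left (V - expectedProfit p c q F) 0]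
  -- For `α = 0` one cannot divide by `α` to reach the infimum over couplings; there `hV`, applied
  -- to any admissible law, already says `V ≤ -c * q`.
  rcases hα.eq_or_lt with rfl | hα'
  · obtain ⟨G, hG⟩ := ambiguitySet_nonempty σ hμ
    have h₁ := hV G hG
    have h₂ : 0 ≤ ∫ v : ℝ≥0, min q (v : ℝ) ∂(F : Measure ℝ≥0) :=
      integral_nonneg fun v => le_min hq v.2
    have h₃ := mul_nonneg hp h₂
    simp only [zero_mul, min_eq_right (mul_nonneg hp hq), integral_zero] at h₁
    rw [ENNReal.ofReal_of_nonpos]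
    · exact zero_le
    · rw [expectedProfit_eq hq]
      linarith
  rw [mul_comm, ← ENNReal.div_le_iff (by simpa using hα') (by simp)]
  refine le_iInf₂ fun G hG => le_iInf₂ fun Γ hΓ => ?_
  rw [ENNReal.div_le_iff (by simpa using hα') (by simp), mul_comm]
  by_cases htop : ∫⁻ z : ℝ≥0 × ℝ≥0, ENNReal.ofReal (|(z.1 : ℝ) - (z.2 : ℝ)| ^ 2)
      ∂(Γ : Measure (ℝ≥0 × ℝ≥0)) = ⊤
  · rw [htop, ENNReal.mul_top (by simpa using hα')]
    exact le_top
  have hint : Integrable (fun z : ℝ≥0 × ℝ≥0 => |(z.1 : ℝ) - (z.2 : ℝ)| ^ 2)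
      (Γ : Measure (ℝ≥0 × ℝ≥0)) :=
    (lintegral_ofReal_ne_top_iff_integrable (Measurable.aestronglyMeasurable (by fun_prop))
      (Filter.Eventually.of_forall fun _ => by positivity)).1 htop
  rw [← ofReal_integral_eq_lintegral_ofReal hint
    (Filter.Eventually.of_forall fun _ => by positivity), ← ENNReal.ofReal_mul hα]
  refine ENNReal.ofReal_le_ofReal ?_
  linarith [hV G hG, integral_min_le_of_coupling (c := c) hα hp hq hqp hΓ hint]

/-- Certificate scheme for both variance cases: the exact objective is needed only at `q₀`, and
upper bounds suffice elsewhere. -/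
theorem isOptimalOrder_iff_of_value {L : ℝ → EReal} {q₀ : ℝ} {V : EReal} (hq₀ : 0 ≤ q₀)
    (hV : V ≤ L q₀) (hle : ∀ q, 0 ≤ q → L q ≤ V) (huniq : ∀ q, 0 ≤ q → V ≤ L q → q = q₀) (q : ℝ) :
    IsOptimalOrder L q ↔ q = q₀ := by
  constructor
  · rintro ⟨hq, h⟩
    exact huniq q hq (hV.trans (h q₀ hq₀))
  · rintro rfl
    exact ⟨hq₀, fun q hq => (hle q hq).trans hV⟩

theorem integrable_coe_of_mem {μ σ : ℝ} {G : ProbabilityMeasure ℝ≥0} (hG : G ∈ ambiguitySet μ σ) :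
    Integrable (fun v : ℝ≥0 => (v : ℝ)) (G : Measure ℝ≥0) := by
  refine ((integrable_const (1 : ℝ)).add hG.1).mono'
    measurable_coe_nnreal_real.aestronglyMeasurable (Filter.Eventually.of_forall fun v => ?_)
  simp only [Pi.add_apply, Real.norm_of_nonneg (NNReal.coe_nonneg v)]
  nlinarith [sq_nonneg ((v : ℝ) - 1)]

theorem integral_quadratic {μ σ : ℝ} {G : ProbabilityMeasure ℝ≥0} (hG : G ∈ ambiguitySet μ σ)
    (a b d : ℝ) :
    Integrable (fun v : ℝ≥0 => a * (v : ℝ) ^ 2 + b * (v : ℝ) + d) (G : Measure ℝ≥0) ∧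
    ∫ v : ℝ≥0, (a * (v : ℝ) ^ 2 + b * (v : ℝ) + d) ∂(G : Measure ℝ≥0) =
      a * (μ ^ 2 + σ ^ 2) + b * μ + d := by
  have i₁ := hG.1.const_mul a
  have i₂ := (integrable_coe_of_mem hG).const_mul b
  have i₃ : Integrable (fun _ : ℝ≥0 => d) (G : Measure ℝ≥0) := integrable_const d
  refine ⟨(i₁.add i₂).add i₃, ?_⟩
  rw [integral_add (f := fun v : ℝ≥0 => a * (v : ℝ) ^ 2 + b * (v : ℝ)) (i₁.add i₂) i₃,
    integral_add i₁ i₂, integral_const_mul, integral_const_mul,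
    hG.2.1, hG.2.2]
  simp

/-! ### The case of zero variance. -/

/-- Under zero variance every admissible law is concentrated at the mean. -/
theorem ae_eq_mean {μ : ℝ} {G : ProbabilityMeasure ℝ≥0} (hG : G ∈ ambiguitySet μ 0) :
    ∀ᵐ v : ℝ≥0 ∂(G : Measure ℝ≥0), (v : ℝ) = μ := by
  obtain ⟨hi, he⟩ := integral_quadratic hG 1 (-2 * μ) (μ ^ 2)
  have hz : (fun v : ℝ≥0 => 1 * (v : ℝ) ^ 2 + -2 * μ * (v : ℝ) + μ ^ 2) =ᵐ[(G : Measure ℝ≥0)] 0 :=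
    (integral_eq_zero_iff_of_nonneg (fun v => by
      simp only [Pi.zero_apply]; nlinarith [sq_nonneg ((v : ℝ) - μ)]) hi).1 (by rw [he]; ring)
  filter_upwards [hz] with v hv
  have : ((v : ℝ) - μ) ^ 2 = 0 := by
    simp only [Pi.zero_apply] at hv
    linarith
  linarith [pow_eq_zero_iff (two_ne_zero) |>.1 this]

/-- Starting from the point mass at `μ`, the adversary can move it to `0` or leave it there. The
resulting bounds `α * μ ^ 2 - c * q` and `(p - c) * q` are strictly decreasing and strictly
increasing in `q`, and their crossing is the unique optimum. -/
theorem isOptimalOrder_misspecification_of_zero_variance {p c α μ : ℝ} (hc : 0 < c) (hα : 0 ≤ α)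
    (hμ : 0 < μ) (hp : c < p) (hpα : 2 * α * μ < p) (q : ℝ) :
    IsOptimalOrder (misspecificationObjective p c α μ 0) q ↔ q = α * μ ^ 2 / p := by
  have hp₀ : 0 < p := hc.trans hp
  have hq₀ : 0 ≤ α * μ ^ 2 / p := by positivity
  have hpq : p * (α * μ ^ 2 / p) = α * μ ^ 2 := by field_simp
  have u₁ : ∀ q, 0 ≤ q →
      misspecificationObjective p c α μ 0 q ≤ ((α * μ ^ 2 - c * q : ℝ) : EReal) := by
    intro q hq
    refine (misspecificationObjective_le_twoPoint hα zero_le_one le_rfl le_rfl le_rfl hμ.le hμ.le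
      (by simp) (by simp)).trans_eq ?_
    congr 1
    simp [profit, min_eq_right hq]
    ring
  have u₂ : ∀ q, 0 ≤ q →
      misspecificationObjective p c α μ 0 q ≤ ((p * q - c * q : ℝ) : EReal) := by
    intro q hq
    refine (misspecificationObjective_le_twoPoint hα zero_le_one le_rfl hμ.le le_rfl hμ.le
      hμ.le (by simp) (by simp)).trans ?_
    rw [EReal.coe_le_coe_iff]
    have : p * min q μ ≤ p * q := by gcongr; exact min_le_left _ _
    simp [profit]
    linarith
  refine isOptimalOrder_iff_of_value (V := ((α * μ ^ 2 - c * (α * μ ^ 2 / p) : ℝ) : EReal)) hq₀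
    ?_ ?_ ?_ q
  · refine le_misspecificationObjective hα hμ hp₀.le hq₀ ?_ fun G hG => ?_
    · rw [← mul_div_assoc, div_le_iff₀ hp₀]
      nlinarith [mul_nonneg hα hμ.le]
    · have : ∫ v : ℝ≥0, min (p * (α * μ ^ 2 / p)) (α * (v : ℝ) ^ 2) ∂(G : Measure ℝ≥0) =
          ∫ _ : ℝ≥0, α * μ ^ 2 ∂(G : Measure ℝ≥0) := by
        refine integral_congr_ae ?_
        filter_upwards [ae_eq_mean hG] with v hv
        rw [hpq, hv, min_self]
      rw [this]
      simp
  · intro q hq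
    rcases le_total (α * μ ^ 2 / p) q with h | h
    · refine (u₁ q hq).trans (EReal.coe_le_coe_iff.2 ?_)
      linarith [mul_le_mul_of_nonneg_left h hc.le]
    · refine (u₂ q hq).trans (EReal.coe_le_coe_iff.2 ?_)
      nlinarith
  · intro q hq hV
    have h₁ := EReal.coe_le_coe_iff.1 (hV.trans (u₁ q hq))
    have h₂ := EReal.coe_le_coe_iff.1 (hV.trans (u₂ q hq))
    refine le_antisymm ?_ ?_
    · exact le_of_mul_le_mul_left (by linarith) hc
    · exact le_of_mul_le_mul_left (a := p - c) (by linarith) (by linarith)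

/-! ### The optimal order for positive variance. -/

/-- Quadratic minorant of `v ↦ min (x y) (v²)`, touching it at `x` and at `y`. -/
theorem quadratic_le_min {x y v : ℝ} (hx : 0 ≤ x) (hy : 0 ≤ y) :
    -x * v ^ 2 + 2 * x * y * v - x ^ 2 * y ≤ (y - x) * min (x * y) (v ^ 2) := by
  rcases min_cases (x * y) (v ^ 2) with ⟨h, -⟩ | ⟨h, -⟩ <;> rw [h]
  · nlinarith [mul_nonneg hx (sq_nonneg (y - v))]
  · nlinarith [mul_nonneg hy (sq_nonneg (v - x))]

/-- Weak duality for the moment problem: the integral of a quadratic depends on `G` only through the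
two prescribed moments. -/
theorem quadratic_bound_le_integral_min {μ σ α x y : ℝ} (hα : 0 ≤ α) (hx : 0 ≤ x) (hy : 0 ≤ y)
    {G : ProbabilityMeasure ℝ≥0} (hG : G ∈ ambiguitySet μ σ) :
    α * (-x * (μ ^ 2 + σ ^ 2) + 2 * x * y * μ - x ^ 2 * y) ≤
      (y - x) * ∫ v : ℝ≥0, min (α * (x * y)) (α * (v : ℝ) ^ 2) ∂(G : Measure ℝ≥0) := by
  obtain ⟨hi, he⟩ := integral_quadratic hG (-x) (2 * x * y) (-(x ^ 2 * y))
  have i : Integrable (fun v : ℝ≥0 => min (x * y) ((v : ℝ) ^ 2)) (G : Measure ℝ≥0) :=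
    integrable_min_left G (by fun_prop) (fun v => by positivity) (mul_nonneg hx hy)
  have h := integral_mono hi (i.const_mul (y - x)) fun v => by
    have := quadratic_le_min (v := (v : ℝ)) hx hy
    simp only
    linarith
  rw [he, integral_const_mul] at h
  simp only [← mul_min_of_nonneg _ _ hα]
  rw [integral_const_mul]
  have := mul_le_mul_of_nonneg_left h hα
  linarith

/-- If a rational function with positive denominator is minimal on `(0, μ)` at `z₀` with value `V`,
its numerator satisfies the first-order condition. -/
theorem first_order_condition {s a m V' z₀ μ b : ℝ} (hz₀ : 0 < z₀) (hz₀μ : z₀ < μ)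
    (h₀ : a * (m - z₀) ^ 2 + z₀ ^ 2 * b - V' * (z₀ ^ 2 + s) = 0)
    (h : ∀ z, 0 < z → z < μ → 0 ≤ a * (m - z) ^ 2 + z ^ 2 * b - V' * (z ^ 2 + s)) :
    z₀ * b = a * (m - z₀) + V' * z₀ := by
  have hmin : IsLocalMin (fun z => a * (m - z) ^ 2 + z ^ 2 * b - V' * (z ^ 2 + s)) z₀ := by
    filter_upwards [Ioo_mem_nhds hz₀ hz₀μ] with z hz
    simp only [h₀]
    exact h z hz.1 hz.2
  have hid := hasDerivAt_id z₀
  have hd : HasDerivAt (fun z => a * (m - z) ^ 2 + z ^ 2 * b - V' * (z ^ 2 + s))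
      (-(2 * a * (m - z₀)) + 2 * z₀ * b - V' * (2 * z₀)) z₀ := by
    refine (((((hid.const_sub m).pow 2).const_mul a).add ((hid.pow 2).mul_const b)).sub
      (((hid.pow 2).add_const s).const_mul V')).congr_deriv ?_
    simp
    ring
  linarith [hmin.hasDerivAt_eq_zero hd]

/-- The optimal order quantity, with the price parametrized as `p = c (1 + r²)`. -/
theorem isOptimalOrder_misspecification {c α μ σ r : ℝ} (hc : 0 < c) (hα : 0 ≤ α) (hμ : 0 < μ)
    (hσ : 0 < σ) (hr : 0 < r) (hx : σ / r < μ)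
    (hkink : 4 * α ^ 2 * ((μ - σ / r) * (μ + σ * r)) ≤ (c * (1 + r ^ 2)) ^ 2) (q : ℝ) :
    IsOptimalOrder (misspecificationObjective (c * (1 + r ^ 2)) c α μ σ) q ↔
      q = α * ((μ - σ / r) * (μ + σ * r)) / (c * (1 + r ^ 2)) := by
  have hp : 0 < c * (1 + r ^ 2) := by positivity
  have hx₀ : 0 < μ - σ / r := sub_pos.2 hx
  have hy₀ : 0 < μ + σ * r := by positivity
  have hxy : μ - σ / r < μ + σ * r := by
    have : 0 < σ / r := by positivity
    have : 0 < σ * r := by positivity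
    linarith
  have hq₀ : 0 ≤ α * ((μ - σ / r) * (μ + σ * r)) / (c * (1 + r ^ 2)) := by positivity
  have hz₀ : 0 < σ / r := by positivity
  -- The cost of sending the lower atom, of mass `r ^ 2 / (1 + r ^ 2)`, to `0`.
  set V : ℝ := α * (μ - σ / r) ^ 2 * r ^ 2 / (1 + r ^ 2) with hVdef
  refine isOptimalOrder_iff_of_value (V := (V : EReal)) hq₀ ?_ ?_ ?_ q
  · refine le_misspecificationObjective hα hμ hp.le hq₀ ?_ fun G hG => ?_
    · rw [← mul_div_assoc, div_le_iff₀ hp]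
      linarith
    · have h := quadratic_bound_le_integral_min hα hx₀.le hy₀.le hG
      have e : c * (1 + r ^ 2) * (α * ((μ - σ / r) * (μ + σ * r)) / (c * (1 + r ^ 2))) =
          α * ((μ - σ / r) * (μ + σ * r)) := by field_simp
      rw [e]
      have e' : α * (-(μ - σ / r) * (μ ^ 2 + σ ^ 2) + 2 * (μ - σ / r) * (μ + σ * r) * μ -
          (μ - σ / r) ^ 2 * (μ + σ * r)) = ((μ + σ * r) - (μ - σ / r)) *
          (V + c * (α * ((μ - σ / r) * (μ + σ * r)) / (c * (1 + r ^ 2)))) := by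
        rw [hVdef]
        field_simp
        ring
      rw [e'] at h
      linarith [le_of_mul_le_mul_left h (sub_pos.2 hxy)]
  · intro q hq
    -- At `z = σ / r` the upper atom has mass `1 / (1 + r ^ 2) = c / p`, so expected revenue and
    -- ordering cost cancel.
    refine (misspecificationObjective_le hp.le hq hα hz₀ hx.le).trans_eq ?_
    congr 1
    rw [hVdef]
    field_simp
    ring
  · intro q hq hV
    -- If `q` attains `V`, the upper bound is at least `V` for every `z` and equals `V` at `σ / r`.
    -- Stationarity there is a linear equation in `q`.
    have hfoc := first_order_condition (s := σ ^ 2) (a := σ ^ 2 * α) (m := μ) (V' := V + c * q)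
      (b := c * (1 + r ^ 2) * q) hz₀ hx (by rw [hVdef]; field_simp; ring) (fun z hz hzμ => by
        have h := EReal.coe_le_coe_iff.1
          (hV.trans (misspecificationObjective_le hp.le hq hα hz hzμ.le))
        have hpos : 0 < z ^ 2 + σ ^ 2 := by positivity
        rw [le_sub_iff_add_le, le_div_iff₀ hpos] at h
        linarith)
    rw [eq_div_iff hp.ne']
    rw [hVdef] at hfoc
    field_simp at hfoc ⊢
    refine mul_right_cancel₀ hr.ne' ?_
    linear_combination hfoc

/-! ### Monotonicity in the price and choice of the threshold. -/

/-- The optimal order quantity decreases in `r` for large `r`. -/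
theorem orderQuantity_antitone {μ σ r s : ℝ} (hμ : 0 < μ) (hσ : 0 < σ) (hr : 1 ≤ r)
    (hx : σ / r < μ) (hR : 5 + 2 * |μ ^ 2 - σ ^ 2| / (μ * σ) ≤ r) (hrs : r ≤ s) :
    (μ - σ / s) * (μ + σ * s) / (1 + s ^ 2) ≤ (μ - σ / r) * (μ + σ * r) / (1 + r ^ 2) := by
  have hr₀ : 0 < r := by linarith
  have hs₀ : 0 < s := by linarith
  have hb : 0 < μ * σ := by positivity
  have hx₀ : 0 < (μ - σ / r) * (μ + σ * r) := mul_pos (sub_pos.2 hx) (by positivity)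
  have hR' : 5 * (μ * σ) + 2 * |μ ^ 2 - σ ^ 2| ≤ r * (μ * σ) := by
    have := mul_le_mul_of_nonneg_right hR hb.le
    rwa [add_mul, div_mul_cancel₀ _ hb.ne'] at this
  have habs := neg_abs_le (μ ^ 2 - σ ^ 2)
  have hinv : 1 / (r * s) ≤ 1 / r ^ 2 := by
    refine one_div_le_one_div_of_le (by positivity) ?_
    nlinarith
  have hinv' : 1 / r ^ 2 ≤ 1 := by
    rw [div_le_one (by positivity)]
    nlinarith
  -- This is the second factor of the cross-multiplied difference, the first being `s - r`.
  -- Replacing `s` by `r` only makes it smaller; the `5` in `hR` then pays for `4 * (μ * σ)` and for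
  -- `μ * σ / r ^ 2 ≤ μ * σ`.
  have key : 0 ≤ ((μ - σ / r) * (μ + σ * r)) * (r + s) -
      μ * σ * (1 + r ^ 2) * (1 + 1 / (r * s)) := by
    have k₁ : ((μ - σ / r) * (μ + σ * r)) * (2 * r) ≤
        ((μ - σ / r) * (μ + σ * r)) * (r + s) := by
      gcongr
      linarith
    have k₂ : μ * σ * (1 + r ^ 2) * (1 + 1 / (r * s)) ≤
        μ * σ * (1 + r ^ 2) * (1 + 1 / r ^ 2) := by
      gcongr
    have k₃ : ((μ - σ / r) * (μ + σ * r)) * (2 * r) - μ * σ * (1 + r ^ 2) * (1 + 1 / r ^ 2) =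
        r * (r * (μ * σ) + 2 * (μ ^ 2 - σ ^ 2)) - 4 * (μ * σ) - μ * σ * (1 / r ^ 2) := by
      field_simp
      ring
    have k₄ : 5 * (μ * σ) ≤ r * (μ * σ) + 2 * (μ ^ 2 - σ ^ 2) := by linarith
    have k₅ : 1 * (5 * (μ * σ)) ≤ r * (r * (μ * σ) + 2 * (μ ^ 2 - σ ^ 2)) := by gcongr
    have k₆ : μ * σ * (1 / r ^ 2) ≤ μ * σ * 1 := by gcongr
    linarith
  rw [div_le_div_iff₀ (by positivity) (by positivity)]
  have e : (μ - σ / r) * (μ + σ * r) * (1 + s ^ 2) - (μ - σ / s) * (μ + σ * s) * (1 + r ^ 2) =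
      (s - r) * (((μ - σ / r) * (μ + σ * r)) * (r + s) -
        μ * σ * (1 + r ^ 2) * (1 + 1 / (r * s))) := by
    field_simp
    ring
  have := mul_nonneg (sub_nonneg.2 hrs) key
  linarith

theorem exists_threshold_of_zero_variance {c μ α : ℝ} (hc : 0 < c) (hμ : 0 < μ) (hα : 0 ≤ α) :
    ∃ pα : ℝ, max ((μ ^ 2 + 0 ^ 2) / μ ^ 2 * c) (2 * α * μ) ≤ pα ∧
      ∃ qstar : ℝ → ℝ,
        (∀ p : ℝ, pα < p → ∀ q : ℝ,
          IsOptimalOrder (misspecificationObjective p c α μ 0) q ↔ q = qstar p) ∧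
        AntitoneOn qstar (Set.Ioi pα) := by
  have hcp : (μ ^ 2 + 0 ^ 2) / μ ^ 2 * c = c := by field_simp; ring
  refine ⟨_, le_rfl, fun p => α * μ ^ 2 / p, fun p hp q => ?_, fun p₁ h₁ p₂ _ h₁₂ => ?_⟩
  · rw [hcp] at hp
    exact isOptimalOrder_misspecification_of_zero_variance hc hα hμ
      ((le_max_left _ _).trans_lt hp) ((le_max_right _ _).trans_lt hp) q
  · have : 0 < p₁ := by
      rw [hcp, Set.mem_Ioi] at h₁
      exact hc.trans ((le_max_left _ _).trans_lt h₁)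
    simp only
    gcongr

theorem exists_threshold {c μ σ α : ℝ} (hc : 0 < c) (hμ : 0 < μ) (hσ : 0 < σ) (hα : 0 ≤ α) :
    ∃ pα : ℝ, max ((μ ^ 2 + σ ^ 2) / μ ^ 2 * c) (2 * α * μ) ≤ pα ∧
      ∃ qstar : ℝ → ℝ,
        (∀ p : ℝ, pα < p → ∀ q : ℝ,
          IsOptimalOrder (misspecificationObjective p c α μ σ) q ↔ q = qstar p) ∧
        AntitoneOn qstar (Set.Ioi pα) := by
  -- `r ≥ R` makes the order quantity decrease; `r ≥ K` gives `4 * α * q ≤ p`, since `x * y ≤ μ * (μ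
  -- + σ) * r` for `r ≥ 1`.
  set R : ℝ := 5 + 2 * |μ ^ 2 - σ ^ 2| / (μ * σ) with hRdef
  set K : ℝ := 4 * α ^ 2 * (μ * (μ + σ)) / c ^ 2 with hKdef
  have hR₀ : 5 ≤ R := le_add_of_nonneg_right (by positivity)
  have hK₀ : 0 ≤ K := by positivity
  set ρ : ℝ → ℝ := fun p => Real.sqrt ((p - c) / c) with hρ
  set pα : ℝ := max (max ((μ ^ 2 + σ ^ 2) / μ ^ 2 * c) (2 * α * μ)) (c * (1 + (R + K) ^ 2))
    with hpα
  have hbase : ∀ p, pα < p → p = c * (1 + ρ p ^ 2) ∧ R + K ≤ ρ p ∧ σ / ρ p < μ := by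
    intro p hp
    have h₁ : (μ ^ 2 + σ ^ 2) / μ ^ 2 * c < p :=
      ((le_max_left _ _).trans (le_max_left _ _)).trans_lt hp
    have h₂ : c * (1 + (R + K) ^ 2) < p := (le_max_right _ _).trans_lt hp
    have hcp : (R + K) ^ 2 ≤ (p - c) / c := by
      rw [le_div_iff₀ hc]
      linarith
    have hsq : ρ p ^ 2 = (p - c) / c := Real.sq_sqrt ((sq_nonneg _).trans hcp)
    have hle : R + K ≤ ρ p := Real.le_sqrt_of_sq_le hcp
    refine ⟨by rw [hsq]; field_simp; ring, hle, ?_⟩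
    have hρ₀ : 0 < ρ p := by linarith
    -- Squared, positivity of the lower atom is exactly `(μ ^ 2 + σ ^ 2) / μ ^ 2 * c < p`.
    rw [div_lt_iff₀ hρ₀]
    refine lt_of_pow_lt_pow_left₀ 2 (by positivity) ?_
    rw [mul_pow, hsq, ← mul_div_assoc, lt_div_iff₀ hc]
    rw [div_mul_eq_mul_div, div_lt_iff₀ (by positivity)] at h₁
    linarith
  refine ⟨pα, le_max_left _ _, fun p => α / c *
    ((μ - σ / ρ p) * (μ + σ * ρ p) / (1 + ρ p ^ 2)), fun p hp q => ?_, fun p₁ h₁ p₂ h₂ h₁₂ => ?_⟩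
  · obtain ⟨hp', hle, hx⟩ := hbase p hp
    have hr₁ : 1 ≤ ρ p := by linarith
    have hr₀ : 0 < ρ p := by linarith
    have hkink : 4 * α ^ 2 * ((μ - σ / ρ p) * (μ + σ * ρ p)) ≤ (c * (1 + ρ p ^ 2)) ^ 2 := by
      have k₁ : (μ - σ / ρ p) * (μ + σ * ρ p) ≤ μ * ((μ + σ) * ρ p) := by
        have : 0 < σ / ρ p := by positivity
        gcongr
        · linarith
        · nlinarith
      have k₂ : 4 * α ^ 2 * (μ * (μ + σ)) ≤ ρ p * c ^ 2 := by
        rw [← div_le_iff₀ (by positivity)]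
        linarith
      calc 4 * α ^ 2 * ((μ - σ / ρ p) * (μ + σ * ρ p))
          ≤ 4 * α ^ 2 * (μ * ((μ + σ) * ρ p)) := by gcongr
        _ = 4 * α ^ 2 * (μ * (μ + σ)) * ρ p := by ring
        _ ≤ ρ p * c ^ 2 * ρ p := by gcongr
        _ ≤ (c * (1 + ρ p ^ 2)) ^ 2 := by
          nlinarith [mul_nonneg (sq_nonneg c) (sq_nonneg (ρ p)),
            mul_nonneg (sq_nonneg c) (sq_nonneg (ρ p ^ 2)), sq_nonneg c]
    have h := isOptimalOrder_misspecification hc hα hμ hσ hr₀ hx hkink q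
    rw [← hp'] at h
    rw [h]
    have hpne : p ≠ 0 := by rw [hp']; positivity
    have e : α * ((μ - σ / ρ p) * (μ + σ * ρ p)) / p =
        α / c * ((μ - σ / ρ p) * (μ + σ * ρ p) / (1 + ρ p ^ 2)) := by
      rw [div_mul_div_comm, ← hp']
    rw [e]
  · obtain ⟨-, hle, hx⟩ := hbase p₁ h₁
    have hρle : ρ p₁ ≤ ρ p₂ := by
      simp only [hρ]
      gcongr
    exact mul_le_mul_of_nonneg_left (orderQuantity_antitone hμ hσ (by linarith) hx (by linarith)
      hρle) (by positivity)

/-! ### The Scarf model. -/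

/-- The worst-case expected sales `inf_{G ∈ A} E_G[min {q, ṽ}]`. -/
noncomputable def worstCaseSales (μ σ q : ℝ) : ℝ :=
  ⨅ G : ambiguitySet μ σ, ∫ v : ℝ≥0, min q (v : ℝ) ∂((G : ProbabilityMeasure ℝ≥0) : Measure ℝ≥0)

section Scarf

variable {p c μ σ q q' : ℝ}

theorem worstCaseSales_le (hq : 0 ≤ q) {G : ProbabilityMeasure ℝ≥0} (hG : G ∈ ambiguitySet μ σ) :
    worstCaseSales μ σ q ≤ ∫ v : ℝ≥0, min q (v : ℝ) ∂(G : Measure ℝ≥0) :=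
  ciInf_le (f := fun G : ambiguitySet μ σ =>
      ∫ v : ℝ≥0, min q (v : ℝ) ∂((G : ProbabilityMeasure ℝ≥0) : Measure ℝ≥0))
    ⟨0, by rintro _ ⟨G, rfl⟩; exact integral_nonneg fun v => le_min hq v.2⟩ ⟨G, hG⟩

theorem le_worstCaseSales (hμ : 0 < μ) {s : ℝ} (h : ∀ G ∈ ambiguitySet μ σ,
    s ≤ ∫ v : ℝ≥0, min q (v : ℝ) ∂(G : Measure ℝ≥0)) : s ≤ worstCaseSales μ σ q :=
  have : Nonempty (ambiguitySet μ σ) := (ambiguitySet_nonempty σ hμ).to_subtype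
  le_ciInf fun G => h G G.2

theorem ambiguityObjective_eq (hp : 0 < p) (hμ : 0 < μ) (hq : 0 ≤ q) :
    ambiguityObjective p c μ σ q = ((p * worstCaseSales μ σ q - c * q : ℝ) : EReal) := by
  refine le_antisymm (EReal.le_of_forall_lt_iff_le.1 fun z hz => ?_)
    (le_iInf₂ fun G hG => EReal.coe_le_coe_iff.2 ?_)
  · have hz' := EReal.coe_lt_coe_iff.1 hz
    by_contra! hlt
    have : (z + c * q) / p ≤ worstCaseSales μ σ q := le_worstCaseSales hμ fun G hG => by
      have h := EReal.coe_lt_coe_iff.1 (hlt.trans_le (iInf₂_le G hG))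
      rw [expectedProfit_eq hq] at h
      rw [div_le_iff₀ hp]
      linarith
    rw [div_le_iff₀ hp] at this
    linarith
  · rw [expectedProfit_eq hq]
    linarith [mul_le_mul_of_nonneg_left (worstCaseSales_le hq hG) hp.le]

theorem worstCaseSales_mono (hμ : 0 < μ) (hq : 0 ≤ q) (h : q ≤ q') :
    worstCaseSales μ σ q ≤ worstCaseSales μ σ q' :=
  le_worstCaseSales hμ fun G hG => (worstCaseSales_le hq hG).trans
    (integral_mono (integrable_min_coe G hq) (integrable_min_coe G (hq.trans h))
      fun _ => min_le_min_right _ h)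

theorem worstCaseSales_le_add (hμ : 0 < μ) (hq : 0 ≤ q) (h : q ≤ q') :
    worstCaseSales μ σ q' ≤ worstCaseSales μ σ q + (q' - q) := by
  rw [← sub_le_iff_le_add]
  refine le_worstCaseSales hμ fun G hG => ?_
  have h₁ := worstCaseSales_le (hq.trans h) hG
  have h₂ := integral_mono (integrable_min_coe G (hq.trans h))
    ((integrable_min_coe G hq).add (integrable_const (q' - q))) fun v => by
      simp only [Pi.add_apply]
      rcases min_cases q (v : ℝ) with ⟨e, -⟩ | ⟨e, -⟩ <;> rw [e]
      · linarith [min_le_left q' (v : ℝ)]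
      · linarith [min_le_right q' (v : ℝ)]
  simp only [Pi.add_apply] at h₂
  rw [integral_add (integrable_min_coe G hq) (integrable_const _)] at h₂
  simp only [integral_const, probReal_univ, one_smul] at h₂
  linarith

theorem continuousOn_worstCaseSales (hμ : 0 < μ) :
    ContinuousOn (worstCaseSales μ σ) (Set.Ici 0) := by
  refine LipschitzOnWith.continuousOn (K := 1) (LipschitzOnWith.of_le_add_mul 1 fun a ha b hb => ?_)
  rw [NNReal.coe_one, one_mul, Real.dist_eq]
  rcases le_total a b with h | h
  · linarith [worstCaseSales_mono (σ := σ) hμ ha h, abs_nonneg (a - b)]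
  · linarith [worstCaseSales_le_add (σ := σ) hμ hb h, le_abs_self (a - b)]

theorem worstCaseSales_zero (hμ : 0 < μ) : worstCaseSales μ σ 0 = 0 := by
  refine le_antisymm ?_ (le_worstCaseSales hμ fun G _ => integral_nonneg fun v => le_min le_rfl v.2)
  obtain ⟨G, hG⟩ := ambiguitySet_nonempty σ hμ
  refine (worstCaseSales_le le_rfl hG).trans_eq ?_
  simp

theorem worstCaseSales_le_mean (hμ : 0 < μ) (hq : 0 ≤ q) : worstCaseSales μ σ q ≤ μ := by
  obtain ⟨G, hG⟩ := ambiguitySet_nonempty σ hμ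
  refine (worstCaseSales_le hq hG).trans ?_
  rw [← hG.2.1]
  exact integral_mono (integrable_min_coe G hq) (integrable_coe_of_mem hG)
    fun v => min_le_right _ _

/-- Worst-case sales are continuous and at most `μ`, so orders beyond `p * μ / c` do no better than
ordering nothing, and a compact interval suffices. -/
theorem exists_isOptimalOrder_ambiguity (hc : 0 < c) (hμ : 0 < μ) (hp : c < p) :
    ∃ q : ℝ, IsOptimalOrder (ambiguityObjective p c μ σ) q := by
  have hp₀ : 0 < p := hc.trans hp
  have hB : 0 ≤ p * μ / c := by positivity
  obtain ⟨q, hq, hmax⟩ := isCompact_Icc.exists_isMaxOn (s := Set.Icc 0 (p * μ / c))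
    ⟨0, le_rfl, hB⟩ (f := fun q => p * worstCaseSales μ σ q - c * q)
    ((((continuousOn_worstCaseSales hμ).mono fun q hq => hq.1).const_mul p).sub
      (continuousOn_id.const_mul c))
  refine ⟨q, hq.1, fun q' hq' => ?_⟩
  rw [ambiguityObjective_eq hp₀ hμ hq', ambiguityObjective_eq hp₀ hμ hq.1, EReal.coe_le_coe_iff]
  rcases le_total q' (p * μ / c) with h | h
  · exact hmax ⟨hq', h⟩
  · have h₀ : p * worstCaseSales μ σ 0 - c * 0 ≤ p * worstCaseSales μ σ q - c * q :=
      hmax ⟨le_rfl, hB⟩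
    rw [worstCaseSales_zero hμ] at h₀
    rw [div_le_iff₀ hc] at h
    have := mul_le_mul_of_nonneg_left (worstCaseSales_le_mean (σ := σ) hμ hq') hp₀.le
    linarith

/-- Exchange argument: adding the two optimality inequalities shows that worst-case sales at `q₁` do
not exceed those at `q₂`. If `q₂ < q₁`, monotonicity makes them equal, and `q₂` would be strictly
better at `p₁` because `c > 0`. -/
theorem isOptimalOrder_ambiguity_mono {p₁ p₂ q₁ q₂ : ℝ} (hc : 0 < c) (hμ : 0 < μ) (hp₁ : c < p₁)
    (hp : p₁ < p₂) (h₁ : IsOptimalOrder (ambiguityObjective p₁ c μ σ) q₁)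
    (h₂ : IsOptimalOrder (ambiguityObjective p₂ c μ σ) q₂) : q₁ ≤ q₂ := by
  have hp₁₀ : 0 < p₁ := hc.trans hp₁
  have hp₂₀ : 0 < p₂ := hp₁₀.trans hp
  have o₁ := h₁.2 q₂ h₂.1
  have o₂ := h₂.2 q₁ h₁.1
  rw [ambiguityObjective_eq hp₁₀ hμ h₁.1, ambiguityObjective_eq hp₁₀ hμ h₂.1,
    EReal.coe_le_coe_iff] at o₁
  rw [ambiguityObjective_eq hp₂₀ hμ h₁.1, ambiguityObjective_eq hp₂₀ hμ h₂.1,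
    EReal.coe_le_coe_iff] at o₂
  by_contra! hlt
  have hm := worstCaseSales_mono (σ := σ) hμ h₂.1 hlt.le
  nlinarith [mul_le_mul_of_nonneg_left hm (sub_pos.2 hp).le, mul_lt_mul_of_pos_left hlt hc]

end Scarf

end Newsvendor

theorem proposition2 (c μ σ α : ℝ) (hc : 0 < c) (hμ : 0 < μ) (hσ : 0 ≤ σ) (hα : 0 ≤ α) :
    -- beyond some threshold, the optimal order quantity exists, is unique and decreases in `p`
    (∃ pα : ℝ, max ((μ ^ 2 + σ ^ 2) / μ ^ 2 * c) (2 * α * μ) ≤ pα ∧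
      ∃ qstar : ℝ → ℝ,
        (∀ p : ℝ, pα < p → ∀ q : ℝ,
          Newsvendor.IsOptimalOrder (Newsvendor.misspecificationObjective p c α μ σ) q ↔
            q = qstar p) ∧
        AntitoneOn qstar (Set.Ioi pα)) ∧
    -- in contrast, optimal order quantities of the Scarf model exist and always increase in `p`
    ((∀ p : ℝ, c < p →
        ∃ q : ℝ, Newsvendor.IsOptimalOrder (Newsvendor.ambiguityObjective p c μ σ) q) ∧
      ∀ p₁ p₂ q₁ q₂ : ℝ, c < p₁ → p₁ < p₂ →
        Newsvendor.IsOptimalOrder (Newsvendor.ambiguityObjective p₁ c μ σ) q₁ →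
        Newsvendor.IsOptimalOrder (Newsvendor.ambiguityObjective p₂ c μ σ) q₂ →
        q₁ ≤ q₂) := by
  refine ⟨?_, fun p hp => Newsvendor.exists_isOptimalOrder_ambiguity hc hμ hp,
    fun p₁ p₂ q₁ q₂ hp₁ hp h₁ h₂ => Newsvendor.isOptimalOrder_ambiguity_mono hc hμ hp₁ hp h₁ h₂⟩
  rcases hσ.eq_or_lt with rfl | hσ
  · exact Newsvendor.exists_threshold_of_zero_variance hc hμ hα
  · exact Newsvendor.exists_threshold hc hμ hσ hα
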